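/- Let $\mathcal A$ be a finite discrete set and let $\sigma:\mathcal A^{\mathbb Z}\to\mathcal A^{\mathbb Z}$, $\sigma(\mathbf a)_z=a_{z-1}$, be the shift. Let $\mathcal A^{\mathbb Z}$ (with the product topology) carry a topological group structure $\bullet$, not necessarily componentwise, for which $\sigma$ is a group automorphism. Let $\Phi:\mathcal A^{\mathbb Z}\to\mathcal A^{\mathbb Z}$ be a group endomorphism that is a bipermutative cellular automaton: there are $\ell,r\ge 0$ and a local rule $\phi:\mathcal A^{[-\ell..r]}\to\mathcal A$ with $\Phi(\mathbf a)_z=\phi(a_{z-\ell},\dots,a_{z+r})$ for all $\mathbf a$ and $z$, such that $\phi$ is bijective in its leftmost argument when all the others are fixed, and bijective in its rightmost argument when all the others are fixed. Let $\mu$ be a Borel probability measure on $\mathcal A^{\mathbb Z}$ that is $\Phi$-invariant and totally $\sigma$-ergodic (i.e. $\sigma^n$-ergodic for every $n\ge1$). Let $\mathfrak B$ be the Borel $\sigma$-algebra, let $\mu_{\mathbf x}$ be the fibre measures, i.e. the regular conditional probabilities of $\mu$ given $\Phi^{-1}(\mathfrak B)$, and put $$\mathcal E(\mathbf x)=\{\mathbf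 y:\ \Phi(\mathbf y)=\Phi(\mathbf x),\ \mu_{\mathbf y}\{\mathbf y\}>0\}.$$ Then there is a finite subgroup $\mathcal J\subseteq\ker\Phi$ with $\sigma^{-1}(\mathcal J)=\mathcal J$ such that: (i) for $\mu$-almost every $\mathbf x$, $\ \mathcal E(\mathbf x)=\operatorname{supp}(\mu_{\mathbf x})=\mathbf x\bullet\mathcal J$; (ii) the Kolmogorov–Sinai entropy satisfies $h_\mu(\Phi)=\log|\mathcal J|$ (the same base of logarithm being used on both sides); (iii) $\Phi$ is $|\mathcal J|$-to-1 $\mu$-almost everywhere: there is a measurable set $\mathcal U$ with $\mu(\mathcal U)=1$, $\ \mu(\Phi^{-1}(\mathcal U)\,\triangle\,\mathcal U)=0$, and $|\mathcal U\cap\Phi^{-1}\{\mathbf u\}|=|\mathcal J|$ for $\mu$-almost every $\mathbf u\in\mathcal U$. -/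

import Mathlib

open MeasureTheory ProbabilityTheory Filter

namespace BipermCA

/-- The shift on `A^ℤ`: `shift a` is the sequence `b` with `b_z = a_{z-1}`. -/
def shift {A : Type*} (a : ℤ → A) : ℤ → A := fun z => a (z - 1)

/-- The map on `A^ℤ` with local rule `φ : A^{[-ℓ..r]} → A`, that is
`Φ(a)_z = φ(a_{z-ℓ}, …, a_{z+r})`; the window is indexed by `Fin (ℓ + r + 1)`. -/
def ofLocalRule {A : Type*} (ℓ r : ℕ) (φ : (Fin (ℓ + r + 1) → A) → A) (a : ℤ → A) : ℤ → A :=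
  fun z => φ (fun i => a (z - (ℓ : ℤ) + ((i : ℕ) : ℤ)))

/-- The rule is a bijection in its rightmost argument, the other ones being fixed. -/
def RightPermutative {A : Type*} {n : ℕ} (φ : (Fin (n + 1) → A) → A) : Prop :=
  ∀ a : Fin n → A, Function.Bijective fun b : A => φ (Fin.snoc (α := fun _ => A) a b)

/-- The rule is a bijection in its leftmost argument, the other ones being fixed. -/
def LeftPermutative {A : Type*} {n : ℕ} (φ : (Fin (n + 1) → A) → A) : Prop :=
  ∀ b : Fin n → A, Function.Bijective fun a : A => φ (Fin.cons (α := fun _ => A) a b)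

/-- `Φ` is a bipermutative cellular automaton: it is given by a local rule on a window
`[-ℓ..r]` with `ℓ, r ≥ 0` that is both left- and right-permutative. -/
def IsBipermutativeCA {A : Type*} (Φ : (ℤ → A) → (ℤ → A)) : Prop :=
  ∃ (ℓ r : ℕ) (φ : (Fin (ℓ + r + 1) → A) → A),
    Φ = ofLocalRule ℓ r φ ∧ LeftPermutative φ ∧ RightPermutative φ

/-- `A^ℤ` with the given multiplication is a group shift: a topological group on which the
(bijective) shift map is a group automorphism. The group structure need not be the
componentwise one. -/
structure IsGroupShift (A : Type*) [TopologicalSpace A] [Group (ℤ → A)] : Prop where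
  isTopologicalGroup : IsTopologicalGroup (ℤ → A)
  shift_mul : ∀ x y : ℤ → A, shift (x * y) = shift x * shift y

/-- `μ` is totally `T`-ergodic: it is `T^n`-ergodic for every `n ≥ 1`. -/
def TotallyErgodic {Ω : Type*} [MeasurableSpace Ω] (T : Ω → Ω) (μ : Measure Ω) : Prop :=
  ∀ n : ℕ, 1 ≤ n → Ergodic (T^[n]) μ

/-- Shannon entropy `-∑ μ(P_i) log μ(P_i)` of the finite partition into the level sets
`P_i = {f = i}`. -/
noncomputable def partitionEntropy {Ω ι : Type*} [MeasurableSpace Ω] [Fintype ι]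
    (μ : Measure Ω) (f : Ω → ι) : ℝ :=
  ∑ i : ι, Real.negMulLog (μ.real (f ⁻¹' {i}))

/-- The partition `⋁_{t < n} T^{-t} 𝒫`, where `𝒫` is the partition into level sets of `f`. -/
def itinerary {Ω ι : Type*} (T : Ω → Ω) (f : Ω → ι) (n : ℕ) : Ω → (Fin n → ι) :=
  fun ω t => f (T^[(t : ℕ)] ω)

/-- `h_μ(T, 𝒫) = lim_n (1/n) H_μ(⋁_{t < n} T^{-t} 𝒫)`; the limit exists for invariant `μ`. -/
noncomputable def entropyOfPartition {Ω ι : Type*} [MeasurableSpace Ω] [Fintype ι]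
    (T : Ω → Ω) (μ : Measure Ω) (f : Ω → ι) : EReal :=
  limsup (fun n : ℕ => ((partitionEntropy μ (itinerary T f n) / (n : ℝ) : ℝ) : EReal)) atTop

/-- Kolmogorov–Sinai entropy: the supremum of `h_μ(T, 𝒫)` over all finite measurable
partitions `𝒫`. -/
noncomputable def entropy {Ω : Type*} [MeasurableSpace Ω] (T : Ω → Ω) (μ : Measure Ω) : EReal :=
  ⨆ (k : ℕ) (f : Ω → Fin k) (_ : Measurable f), entropyOfPartition T μ f

/-- The fibre measure `μ_x`: the regular conditional probability of `μ` given the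
sigma-algebra `Φ⁻¹(𝔅)`, at the point `x`. -/
noncomputable def fibreMeasure {Ω : Type*} [mΩ : MeasurableSpace Ω] [StandardBorelSpace Ω]
    (Φ : Ω → Ω) (μ : Measure Ω) [IsFiniteMeasure μ] (x : Ω) : Measure Ω :=
  condExpKernel μ (MeasurableSpace.comap Φ mΩ) x

/-- `ℰ(x) = {y ∈ Φ⁻¹{Φ(x)} : η(y) > 0}`, where `η(y) = μ_y{y}`. -/
def fibreAtoms {Ω : Type*} [MeasurableSpace Ω] [StandardBorelSpace Ω]
    (Φ : Ω → Ω) (μ : Measure Ω) [IsFiniteMeasure μ] (x : Ω) : Set Ω :=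
  {y | Φ y = Φ x ∧ 0 < fibreMeasure Φ μ y {y}}

/-- `Φ` is `K`-to-1 `μ`-almost everywhere: there is a set `U` of full measure with
`Φ⁻¹(U) = U` modulo `μ` such that almost every `u ∈ U` has exactly `K` preimages in `U`. -/
def IsAEToOne {Ω : Type*} [MeasurableSpace Ω] (Φ : Ω → Ω) (μ : Measure Ω) (K : ℕ) : Prop :=
  ∃ U : Set Ω, MeasurableSet U ∧ μ U = 1 ∧ Φ ⁻¹' U =ᵐ[μ] U ∧
    ∀ᵐ u ∂μ, u ∈ U → (U ∩ Φ ⁻¹' {u}).encard = (K : ℕ∞)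

end BipermCA

/-!
Let `J` be the set of `k ∈ ker Φ` whose right translation `x ↦ x * k` preserves `μ`. Bipermutativity
makes `ker Φ` finite, so some power `σ^n` fixes it pointwise; translation by `k ∈ ker Φ` then
commutes with `σ^n`, and since `μ` is `σ^n`-ergodic its translate by `k` is either `μ` itself or
singular to `μ`. Hence a single measurable set meets almost every fibre `x * ker Φ` exactly in
`x * J`, and averaging over `J` shows that the fibre measure at `x` is uniform on `x * J`.

The window `[-ℓ..r)` of `x` and the block `Φ(x)|[-n..n)` together determine `x|[-n..n)`. Letting
`n → ∞`, the entropy of `Φ` is the conditional entropy of the window given `Φ⁻¹(𝔅)`. The window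
separates the points of each fibre, so this is the mean entropy of the uniform measures on the sets
`x * J`, namely `log |J|`.
-/

namespace BipermCA

open scoped Topology Pointwise

lemma partitionEntropy_prodMk_comm {Ω α β : Type*} [MeasurableSpace Ω] [Fintype α] [Fintype β]
    {μ : Measure Ω} (f : Ω → α) (g : Ω → β) :
    partitionEntropy μ (fun x => (f x, g x)) = partitionEntropy μ (fun x => (g x, f x)) := by
  simp only [partitionEntropy, ← Set.singleton_prod_singleton, Set.mk_preimage_prod, Set.inter_comm,
    Fintype.sum_prod_type]
  exact Finset.sum_comm

lemma partitionEntropy_comp {Ω α : Type*} [MeasurableSpace Ω] [Fintype α] [MeasurableSpace α]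
    [MeasurableSingletonClass α] {μ : Measure Ω} {T : Ω → Ω} (hT : MeasurePreserving T μ μ)
    {f : Ω → α} (hf : Measurable f) : partitionEntropy μ (f ∘ T) = partitionEntropy μ f :=
  Finset.sum_congr rfl fun i _ => by
    rw [Set.preimage_comp,
      hT.measureReal_preimage (hf (measurableSet_singleton i)).nullMeasurableSet]

lemma measurable_comap_of_factorsThrough {Ω α β : Type*} [Finite α] [MeasurableSpace α]
    [MeasurableSingletonClass α] [MeasurableSpace β] {f : Ω → α} {g : Ω → β}
    (h : g.FactorsThrough f) : Measurable[MeasurableSpace.comap f inferInstance] g := fun s _ =>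
  ⟨f '' (g ⁻¹' s), (Set.toFinite _).measurableSet, by
    ext x
    constructor
    · rintro ⟨y, hy, hyx⟩
      rwa [Set.mem_preimage, ← h hyx]
    · exact fun hx => ⟨x, hx, rfl⟩⟩

section ConditionalEntropy

variable {Ω : Type*} {m m₁ m₂ mΩ : MeasurableSpace Ω} {μ : Measure Ω} [IsFiniteMeasure μ]
  {α β γ δ : Type*} [Fintype α] [MeasurableSpace α] [MeasurableSingletonClass α]
  [Fintype β] [MeasurableSpace β] [MeasurableSingletonClass β]
  [Fintype γ] [MeasurableSpace γ] [MeasurableSingletonClass γ]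
  [MeasurableSpace δ]

/-- The conditional entropy `H_μ(𝒫 | m)` of the finite partition `𝒫` into level sets of `g` given
the σ-algebra `m`, defined as the mean entropy of the conditional probabilities `μ(· | m)`. -/
noncomputable def condPartitionEntropy (μ : Measure Ω) (m : MeasurableSpace Ω) (g : Ω → β) : ℝ :=
  ∫ x, ∑ j, Real.negMulLog ((μ⟦g ⁻¹' {j} | m⟧) x) ∂μ

lemma condExp_indicator_one_mem_Icc (hm : m ≤ mΩ) {s : Set Ω}
    (hs : MeasurableSet[mΩ] s) : ∀ᵐ x ∂μ, (μ⟦s | m⟧) x ∈ Set.Icc (0 : ℝ) 1 := by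
  have h0 : 0 ≤ᵐ[μ] μ⟦s | m⟧ :=
    condExp_nonneg (ae_of_all _ (Set.indicator_nonneg fun _ _ => zero_le_one))
  have h1 : μ⟦s | m⟧ ≤ᵐ[μ] μ[fun _ => (1 : ℝ) | m] :=
    condExp_mono ((integrable_const 1).indicator hs) (integrable_const 1)
      (ae_of_all _ (Set.indicator_le_self' fun _ _ => zero_le_one))
  rw [condExp_const hm] at h1
  filter_upwards [h0, h1] with x h0 h1 using ⟨h0, h1⟩

omit [Fintype β] in
lemma negMulLog_condExp_mem_Icc [Finite β] (hm : m ≤ mΩ) {g : Ω → β} (hg : Measurable g) :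
    ∀ᵐ x ∂μ, ∀ j, Real.negMulLog ((μ⟦g ⁻¹' {j} | m⟧) x) ∈ Set.Icc (0 : ℝ) 1 := by
  filter_upwards [ae_all_iff.2 fun j =>
    condExp_indicator_one_mem_Icc (μ := μ) hm (hg (measurableSet_singleton j))] with x hx j
  obtain ⟨h0, h1⟩ := hx j
  exact ⟨Real.negMulLog_nonneg h0 h1,
    (Real.negMulLog_le_one_sub_self h0).trans (sub_le_self 1 h0)⟩

omit [Fintype β] in
lemma integrable_negMulLog_condExp [Finite β] (hm : m ≤ mΩ) {g : Ω → β}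
    (hg : Measurable g) (j : β) :
    Integrable (fun x => Real.negMulLog ((μ⟦g ⁻¹' {j} | m⟧) x)) μ :=
  .of_mem_Icc 0 1 (Real.continuous_negMulLog.comp_aestronglyMeasurable
    integrable_condExp.aestronglyMeasurable).aemeasurable
    ((negMulLog_condExp_mem_Icc hm hg).mono fun _ h => h j)

lemma condPartitionEntropy_nonneg (hm : m ≤ mΩ) {g : Ω → β} (hg : Measurable g) :
    0 ≤ condPartitionEntropy μ m g :=
  integral_nonneg_of_ae ((negMulLog_condExp_mem_Icc hm hg).mono fun _ h =>
    Finset.sum_nonneg fun j _ => (h j).1)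

lemma condPartitionEntropy_eq_zero (hm : m ≤ mΩ) {g : Ω → β} (hg : Measurable[m] g) :
    condPartitionEntropy μ m g = 0 := by
  refine integral_eq_zero_of_ae (ae_of_all _ fun x => Finset.sum_eq_zero fun j _ => ?_)
  have hj : MeasurableSet[m] (g ⁻¹' {j}) := hg (measurableSet_singleton j)
  rw [condExp_of_stronglyMeasurable hm (stronglyMeasurable_const.indicator hj)
    ((integrable_const 1).indicator (hm _ hj))]
  by_cases hx : x ∈ g ⁻¹' {j} <;> simp [hx]

lemma condPartitionEntropy_anti (h₁₂ : m₁ ≤ m₂) (hm₂ : m₂ ≤ mΩ) {g : Ω → β}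
    (hg : Measurable g) : condPartitionEntropy μ m₂ g ≤ condPartitionEntropy μ m₁ g := by
  have hint (m : MeasurableSpace Ω) (hm : m ≤ mΩ) (j : β) :=
    integrable_negMulLog_condExp (μ := μ) hm hg j
  rw [condPartitionEntropy, condPartitionEntropy,
    integral_finsetSum _ fun j _ => hint m₂ hm₂ j,
    integral_finsetSum _ fun j _ => hint m₁ (h₁₂.trans hm₂) j]
  refine Finset.sum_le_sum fun j _ => ?_
  have jensen : μ[Real.negMulLog ∘ μ⟦g ⁻¹' {j} | m₂⟧ | m₁] ≤ᵐ[μ]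
      Real.negMulLog ∘ μ[μ⟦g ⁻¹' {j} | m₂⟧ | m₁] :=
    Real.concaveOn_negMulLog.condExp_map_le (h₁₂.trans hm₂)
      Real.continuous_negMulLog.continuousOn.upperSemicontinuousOn
      ((condExp_indicator_one_mem_Icc hm₂ (hg (measurableSet_singleton j))).mono fun _ h => h.1)
      isClosed_Ici integrable_condExp (hint m₂ hm₂ j)
  rw [← integral_condExp (h₁₂.trans hm₂)]
  refine integral_mono_ae integrable_condExp (hint m₁ (h₁₂.trans hm₂) j) ?_
  filter_upwards [jensen, condExp_condExp_of_le (f := (g ⁻¹' {j}).indicator fun _ => (1 : ℝ))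
    h₁₂ hm₂] with x hx htower
  rw [Function.comp_apply, htower] at hx
  exact hx

lemma tendsto_condPartitionEntropy_iSup {m : ℕ → MeasurableSpace Ω} (hmono : Monotone m)
    (hm : ∀ n, m n ≤ mΩ) {g : Ω → β} (hg : Measurable g) :
    Tendsto (fun n => condPartitionEntropy μ (m n) g) atTop
      (𝓝 (condPartitionEntropy μ (⨆ n, m n) g)) := by
  have hlim : ∀ᵐ x ∂μ, ∀ j, Tendsto (fun n => (μ⟦g ⁻¹' {j} | m n⟧) x) atTop
      (𝓝 ((μ⟦g ⁻¹' {j} | ⨆ n, m n⟧) x)) :=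
    ae_all_iff.2 fun j => tendsto_ae_condExp (ℱ := ⟨m, hmono, hm⟩) _
  refine tendsto_integral_of_dominated_convergence (fun _ => ∑ _j : β, 1)
    (fun n => (integrable_finsetSum _ fun j _ =>
      integrable_negMulLog_condExp (hm n) hg j).aestronglyMeasurable) (integrable_const _)
    (fun n => ?_) ?_
  · filter_upwards [negMulLog_condExp_mem_Icc (hm n) hg] with x hx
    refine (norm_sum_le _ _).trans (Finset.sum_le_sum fun j _ => ?_)
    exact (Real.norm_of_nonneg (hx j).1).trans_le (hx j).2
  · filter_upwards [hlim] with x hx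
    exact tendsto_finsetSum _ fun j _ => (Real.continuous_negMulLog.tendsto _).comp (hx j)

lemma sum_measureReal_inter_fiber {f : Ω → α}
    (hf : Measurable f) (s : Set Ω) : ∑ i, μ.real (s ∩ f ⁻¹' {i}) = μ.real s := by
  simpa [measureReal_restrict_apply (hf (measurableSet_singleton _)), Set.inter_comm] using
    sum_measureReal_preimage_singleton (μ := μ.restrict s) Finset.univ (f := f)
      fun i _ => hf (measurableSet_singleton i)

omit [Fintype α] in
lemma ae_measureReal_fiber_ne_zero [Countable α] {f : Ω → α} (hf : Measurable f) :
    ∀ᵐ x ∂μ, μ.real (f ⁻¹' {f x}) ≠ 0 := by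
  have h : ∀ᵐ i ∂μ.map f, μ.map f {i} ≠ 0 := ae_iff_of_countable.2 fun _ h => h
  filter_upwards [ae_of_ae_map hf.aemeasurable h] with x hx
  rwa [Measure.map_apply hf (measurableSet_singleton _), ← measureReal_ne_zero_iff] at hx

omit [Fintype α] [Fintype β] in
lemma condExp_comap_ae_eq_div [Countable α] [Countable β] {f : Ω → α} {g : Ω → β}
    (hf : Measurable f) (hg : Measurable g) (j : β) :
    μ⟦g ⁻¹' {j} | MeasurableSpace.comap f inferInstance⟧ =ᵐ[μ] fun x =>
      μ.real (f ⁻¹' {f x} ∩ g ⁻¹' {j}) / μ.real (f ⁻¹' {f x}) := by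
  have : Nonempty β := ⟨j⟩
  filter_upwards [condDistrib_ae_eq_condExp hf hg (measurableSet_singleton j),
    ae_measureReal_fiber_ne_zero hf] with x hx hne
  rw [measureReal_ne_zero_iff, ← Measure.map_apply hf (measurableSet_singleton _)] at hne
  rw [← hx, measureReal_def, condDistrib_apply_of_ne_zero hg _ hne, ENNReal.toReal_mul,
    Measure.map_apply hf (measurableSet_singleton _), Measure.map_apply (hf.prodMk hg)
      ((measurableSet_singleton _).prod (measurableSet_singleton _)), Set.mk_preimage_prod,
    ENNReal.toReal_inv, mul_comm, ← div_eq_mul_inv]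
  rfl

lemma condPartitionEntropy_comap {f : Ω → α} {g : Ω → β} (hf : Measurable f)
    (hg : Measurable g) :
    condPartitionEntropy μ (MeasurableSpace.comap f inferInstance) g =
      ∑ i, μ.real (f ⁻¹' {i}) *
        ∑ j, Real.negMulLog (μ.real (f ⁻¹' {i} ∩ g ⁻¹' {j}) / μ.real (f ⁻¹' {i})) := by
  set H : α → ℝ := fun i =>
    ∑ j, Real.negMulLog (μ.real (f ⁻¹' {i} ∩ g ⁻¹' {j}) / μ.real (f ⁻¹' {i}))
  have hH : Integrable H (μ.map f) := .of_finite
  calc _ = ∫ x, H (f x) ∂μ := by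
        refine integral_congr_ae ?_
        filter_upwards [ae_all_iff.2 fun j => condExp_comap_ae_eq_div (μ := μ) hf hg j] with x hx
        exact Finset.sum_congr rfl fun j _ => by rw [hx j]
    _ = ∑ i, μ.real (f ⁻¹' {i}) * H i := by
        rw [← integral_map hf.aemeasurable hH.aestronglyMeasurable, integral_fintype hH]
        simp only [map_measureReal_apply hf (measurableSet_singleton _), smul_eq_mul]

theorem partitionEntropy_prodMk {f : Ω → α} {g : Ω → β} (hf : Measurable f) (hg : Measurable g) :
    partitionEntropy μ (fun x => (f x, g x)) = partitionEntropy μ f +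
      condPartitionEntropy μ (MeasurableSpace.comap f inferInstance) g := by
  have hjoint : partitionEntropy μ (fun x => (f x, g x)) =
      ∑ i, ∑ j, Real.negMulLog (μ.real (f ⁻¹' {i} ∩ g ⁻¹' {j})) := by
    simp only [partitionEntropy, Fintype.sum_prod_type, ← Set.singleton_prod_singleton,
      Set.mk_preimage_prod]
  rw [condPartitionEntropy_comap hf hg, hjoint, partitionEntropy, ← Finset.sum_add_distrib]
  refine Finset.sum_congr rfl fun i _ => ?_
  set p := μ.real (f ⁻¹' {i})
  set q : β → ℝ := fun j => μ.real (f ⁻¹' {i} ∩ g ⁻¹' {j})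
  rcases eq_or_ne p 0 with hp | hp
  · have hq (j) : q j = 0 :=
      le_antisymm (hp ▸ measureReal_mono Set.inter_subset_left) measureReal_nonneg
    simp only [hp, zero_mul, Real.negMulLog_zero, add_zero]
    exact Finset.sum_eq_zero fun j _ => (congrArg _ (hq j)).trans Real.negMulLog_zero
  calc ∑ j, Real.negMulLog (q j) = ∑ j, Real.negMulLog (p * (q j / p)) := by
        simp only [mul_div_cancel₀ _ hp]
    _ = (∑ j, q j / p) * Real.negMulLog p + p * ∑ j, Real.negMulLog (q j / p) := by
        simp only [Real.negMulLog_mul, Finset.sum_add_distrib, Finset.sum_mul, Finset.mul_sum]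
    _ = Real.negMulLog p + p * ∑ j, Real.negMulLog (q j / p) := by
        rw [← Finset.sum_div, sum_measureReal_inter_fiber hg, div_self hp, one_mul]

lemma partitionEntropy_prodMk_of_factorsThrough {f : Ω → α} {g : Ω → β} (hf : Measurable f)
    (h : g.FactorsThrough f) : partitionEntropy μ (fun x => (f x, g x)) = partitionEntropy μ f := by
  have hg := measurable_comap_of_factorsThrough h
  rw [partitionEntropy_prodMk hf (hg.mono hf.comap_le le_rfl),
    condPartitionEntropy_eq_zero hf.comap_le hg, add_zero]

lemma partitionEntropy_mono {f : Ω → α} {g : Ω → β} (hf : Measurable f) (h : g.FactorsThrough f) :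
    partitionEntropy μ g ≤ partitionEntropy μ f := by
  have hg : Measurable g := (measurable_comap_of_factorsThrough h).mono hf.comap_le le_rfl
  rw [← partitionEntropy_prodMk_of_factorsThrough hf h, partitionEntropy_prodMk_comm,
    partitionEntropy_prodMk hg hf]
  exact le_add_of_nonneg_right (condPartitionEntropy_nonneg hg.comap_le hf)

omit [Fintype α] in
lemma condPartitionEntropy_prodMk_le [Finite α] {f : Ω → α} {g : Ω → β} {h : Ω → γ} {p : Ω → δ}
    (hf : Measurable f) (hg : Measurable g) (hh : Measurable h)
    (hp : p.FactorsThrough fun x => (f x, g x)) :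
    condPartitionEntropy μ (MeasurableSpace.comap f inferInstance) (fun x => (g x, h x)) ≤
      condPartitionEntropy μ (MeasurableSpace.comap f inferInstance) g +
        condPartitionEntropy μ (MeasurableSpace.comap p inferInstance) h := by
  have := Fintype.ofFinite α
  have hfg := hf.prodMk hg
  have hassoc : partitionEntropy μ (fun x => (f x, g x, h x)) ≤
      partitionEntropy μ (fun x => ((f x, g x), h x)) :=
    partitionEntropy_mono (hfg.prodMk hh) fun x y hxy => by simp_all
  have hanti := condPartitionEntropy_anti (μ := μ)
    (measurable_comap_of_factorsThrough hp).comap_le hfg.comap_le hh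
  rw [partitionEntropy_prodMk hf (hg.prodMk hh), partitionEntropy_prodMk hfg hh,
    partitionEntropy_prodMk hf hg] at hassoc
  linarith

end ConditionalEntropy

section Entropy

variable {Ω : Type*} [mΩ : MeasurableSpace Ω] {μ : Measure Ω} {T : Ω → Ω}
  {α β : Type*} [Fintype α] [MeasurableSpace α] [MeasurableSingletonClass α]
  [Fintype β] [MeasurableSpace β] [MeasurableSingletonClass β]

omit [MeasurableSpace Ω] [Fintype α] [MeasurableSpace α] [MeasurableSingletonClass α] in
lemma itinerary_succ (T : Ω → Ω) (f : Ω → α) (n : ℕ) (x : Ω) :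
    itinerary T f (n + 1) x = Fin.cons (f x) (itinerary T f n (T x)) :=
  funext (Fin.cases rfl fun _ => rfl)

omit [Fintype α] [MeasurableSingletonClass α] in
lemma measurable_itinerary (hT : Measurable T) {f : Ω → α} (hf : Measurable f) (n : ℕ) :
    Measurable (itinerary T f n) :=
  measurable_pi_lambda _ fun t => hf.comp (hT.iterate t)

omit [MeasurableSpace α] [MeasurableSingletonClass α] in
lemma entropyOfPartition_le_of_forall_le {f : Ω → α} {C c : ℝ}
    (h : ∀ n : ℕ, partitionEntropy μ (itinerary T f n) ≤ C + n * c) :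
    entropyOfPartition T μ f ≤ c := by
  have hlim : Tendsto (fun n : ℕ => C / n + c) atTop (𝓝 c) := by
    simpa using (tendsto_const_div_atTop_nhds_zero_nat C).add_const c
  rw [← ((continuous_coe_real_ereal.tendsto c).comp hlim).limsup_eq]
  refine limsup_le_limsup ?_
  filter_upwards [eventually_gt_atTop 0] with n hn
  have hn' : (0 : ℝ) < n := Nat.cast_pos.2 hn
  rw [Function.comp_apply, EReal.coe_le_coe_iff, div_add' _ _ _ hn'.ne', mul_comm c]
  gcongr
  exact h n

omit [MeasurableSpace α] [MeasurableSingletonClass α] in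
lemma le_entropyOfPartition_of_forall_le {f : Ω → α} {c : ℝ}
    (h : ∀ n : ℕ, n * c ≤ partitionEntropy μ (itinerary T f n)) :
    c ≤ entropyOfPartition T μ f := by
  refine le_limsup_of_frequently_le (Eventually.frequently ?_)
  filter_upwards [eventually_gt_atTop 0] with n hn
  rw [EReal.coe_le_coe_iff, le_div_iff₀' (Nat.cast_pos.2 hn)]
  exact h n

lemma entropyOfPartition_le_entropy [IsFiniteMeasure μ] (hT : Measurable T) {f : Ω → α}
    (hf : Measurable f) : entropyOfPartition T μ f ≤ entropy T μ := by
  set e := Fintype.equivFin α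
  have he : Measurable (e ∘ f) := (measurable_of_finite e).comp hf
  refine le_trans (limsup_le_limsup (Eventually.of_forall fun n => ?_))
    (le_iSup_of_le _ (le_iSup₂_of_le (e ∘ f) he le_rfl))
  refine EReal.coe_le_coe_iff.2 (div_le_div_of_nonneg_right ?_ n.cast_nonneg)
  exact partitionEntropy_mono (measurable_itinerary hT he n) fun x y hxy =>
    funext fun t => e.injective (congrFun hxy t)

lemma nat_mul_condPartitionEntropy_le [IsProbabilityMeasure μ] (hT : MeasurePreserving T μ μ)
    {f : Ω → α} (hf : Measurable f) (n : ℕ) :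
    n * condPartitionEntropy μ (MeasurableSpace.comap T mΩ) f ≤
      partitionEntropy μ (itinerary T f n) := by
  have hit := measurable_itinerary hT.measurable hf
  induction n with
  | zero =>
    have huniv : itinerary T f 0 ⁻¹' {default} = Set.univ :=
      Set.eq_univ_of_forall fun _ => Subsingleton.elim _ _
    simp [partitionEntropy, huniv]
  | succ n ih =>
    have hitT : Measurable (itinerary T f n ∘ T) := (hit n).comp hT.measurable
    have hcomap : MeasurableSpace.comap (itinerary T f n ∘ T) inferInstance ≤
        MeasurableSpace.comap T mΩ := by
      rw [← MeasurableSpace.comap_comp]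
      exact MeasurableSpace.comap_mono (hit n).comap_le
    calc _ = n * condPartitionEntropy μ (MeasurableSpace.comap T mΩ) f +
            condPartitionEntropy μ (MeasurableSpace.comap T mΩ) f := by push_cast; ring
      _ ≤ partitionEntropy μ (itinerary T f n ∘ T) +
            condPartitionEntropy μ (MeasurableSpace.comap (itinerary T f n ∘ T) inferInstance) f :=
          add_le_add (ih.trans_eq (partitionEntropy_comp hT (hit n)).symm)
            (condPartitionEntropy_anti hcomap hT.measurable.comap_le hf)
      _ = partitionEntropy μ (fun x => ((itinerary T f n ∘ T) x, f x)) :=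
          (partitionEntropy_prodMk hitT hf).symm
      _ ≤ partitionEntropy μ (itinerary T f (n + 1)) :=
          partitionEntropy_mono (hit _) fun x y hxy => by
            simpa [itinerary_succ, Fin.cons_inj, and_comm] using hxy

omit [MeasurableSpace Ω] [Fintype α] [MeasurableSpace α] [MeasurableSingletonClass α]
  [Fintype β] [MeasurableSpace β] [MeasurableSingletonClass β] in
lemma factorsThrough_itinerary_prodMk_iterate {f : Ω → α} {p : Ω → β}
    (h : p.FactorsThrough fun x => (p (T x), f x)) (n : ℕ) :
    p.FactorsThrough fun x => (itinerary T f n x, p (T^[n] x)) := by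
  induction n with
  | zero => exact fun x y hxy => (Prod.ext_iff.1 hxy).2
  | succ n ih =>
    intro x y hxy
    simp only [itinerary_succ, Fin.cons_inj, Prod.mk.injEq, Function.iterate_succ_apply] at hxy
    exact h (Prod.ext (ih (Prod.ext hxy.1.2 hxy.2)) hxy.1.1)

lemma partitionEntropy_itinerary_le [IsFiniteMeasure μ] (hT : MeasurePreserving T μ μ)
    {f : Ω → α} {p : Ω → β} (hf : Measurable f) (hp : Measurable p)
    (h : p.FactorsThrough fun x => (p (T x), f x)) (n : ℕ) :
    partitionEntropy μ (itinerary T f n) ≤ partitionEntropy μ p +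
      n * condPartitionEntropy μ (MeasurableSpace.comap (p ∘ T) inferInstance) f := by
  set c := condPartitionEntropy μ (MeasurableSpace.comap (p ∘ T) inferInstance) f
  have hjoint (n : ℕ) : Measurable fun x => (itinerary T f n x, p (T^[n] x)) :=
    (measurable_itinerary hT.measurable hf n).prodMk (hp.comp (hT.measurable.iterate n))
  -- Unlike the itinerary alone, the pair with `p ∘ T^[n]` determines `p`, so that conditioning on
  -- its composition with `T` is at least as strong as conditioning on `p ∘ T`.
  suffices hind : partitionEntropy μ (fun x => (itinerary T f n x, p (T^[n] x))) ≤
      partitionEntropy μ p + n * c from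
    (partitionEntropy_mono (hjoint n) fun x y hxy => (Prod.ext_iff.1 hxy).1).trans hind
  induction n with
  | zero =>
    rw [Nat.cast_zero, zero_mul, add_zero]
    exact partitionEntropy_mono hp fun x y hxy => Prod.ext (Subsingleton.elim _ _) hxy
  | succ n ih =>
    set z : Ω → (Fin n → α) × β := fun x => (itinerary T f n x, p (T^[n] x))
    have hzT : Measurable (z ∘ T) := (hjoint n).comp hT.measurable
    have hpz : (p ∘ T).FactorsThrough (z ∘ T) := fun x y hxy =>
      factorsThrough_itinerary_prodMk_iterate h n hxy
    calc _ ≤ partitionEntropy μ (fun x => ((z ∘ T) x, f x)) :=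
          partitionEntropy_mono (hzT.prodMk hf) fun x y hxy => by
            simp_all [z, itinerary_succ]
      _ = partitionEntropy μ z +
            condPartitionEntropy μ (MeasurableSpace.comap (z ∘ T) inferInstance) f := by
          rw [partitionEntropy_prodMk hzT hf, partitionEntropy_comp hT (hjoint n)]
      _ ≤ (partitionEntropy μ p + n * c) + c :=
          add_le_add ih (condPartitionEntropy_anti
            (measurable_comap_of_factorsThrough hpz).comap_le hzT.comap_le hf)
      _ = partitionEntropy μ p + (n + 1 : ℕ) * c := by push_cast; ring

omit [Fintype β] in
lemma entropyOfPartition_le_add [Finite β] [IsFiniteMeasure μ] (hT : MeasurePreserving T μ μ)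
    {γ : Type*} [Fintype γ] [MeasurableSpace γ] [MeasurableSingletonClass γ]
    {f : Ω → α} {p : Ω → β} {w : Ω → γ}
    (hf : Measurable f) (hp : Measurable p) (hw : Measurable w)
    (h : p.FactorsThrough fun x => (p (T x), w x)) :
    entropyOfPartition T μ f ≤
      (condPartitionEntropy μ (MeasurableSpace.comap (p ∘ T) inferInstance) w +
        condPartitionEntropy μ (MeasurableSpace.comap p inferInstance) f : ℝ) := by
  have := Fintype.ofFinite β
  have hwf := hw.prodMk hf
  refine entropyOfPartition_le_of_forall_le (C := partitionEntropy μ p) fun n => ?_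
  calc partitionEntropy μ (itinerary T f n)
      ≤ partitionEntropy μ (itinerary T (fun x => (w x, f x)) n) :=
        partitionEntropy_mono (measurable_itinerary hT.measurable hwf n) fun x y hxy =>
          funext fun t => (Prod.ext_iff.1 (congrFun hxy t)).2
    _ ≤ partitionEntropy μ p + n * condPartitionEntropy μ
          (MeasurableSpace.comap (p ∘ T) inferInstance) fun x => (w x, f x) :=
        partitionEntropy_itinerary_le hT hwf hp (fun x y hxy => h (by simp_all)) n
    _ ≤ _ := by
        gcongr
        exact condPartitionEntropy_prodMk_le (hp.comp hT.measurable) hw hf h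

theorem entropy_eq_condPartitionEntropy_comap [IsProbabilityMeasure μ]
    (hT : MeasurePreserving T μ μ) {ι : ℕ → Type*}
    [∀ n, Finite (ι n)] [∀ n, MeasurableSpace (ι n)] [∀ n, MeasurableSingletonClass (ι n)]
    {p : ∀ n, Ω → ι n} (hp : ∀ n, Measurable (p n))
    (hmono : Monotone fun n => MeasurableSpace.comap (p n) inferInstance)
    (hsup : ⨆ n, MeasurableSpace.comap (p n) inferInstance = mΩ)
    {w : Ω → α} (hw : Measurable w) (h : ∀ n, (p n).FactorsThrough fun x => (p n (T x), w x)) :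
    entropy T μ = (condPartitionEntropy μ (MeasurableSpace.comap T mΩ) w : ℝ) := by
  refine le_antisymm (iSup_le fun k => iSup₂_le fun f hf => ?_)
    ((le_entropyOfPartition_of_forall_le (nat_mul_condPartitionEntropy_le hT hw)).trans
      (entropyOfPartition_le_entropy hT.measurable hw))
  have hw_lim : Tendsto (fun n => condPartitionEntropy μ
      (MeasurableSpace.comap (p n ∘ T) inferInstance) w) atTop
      (𝓝 (condPartitionEntropy μ (MeasurableSpace.comap T mΩ) w)) := by
    have hsupT : ⨆ n, MeasurableSpace.comap (p n ∘ T) inferInstance =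
        MeasurableSpace.comap T mΩ := by
      simp only [← hsup, MeasurableSpace.comap_iSup, MeasurableSpace.comap_comp]
    have hmonoT : Monotone fun n => MeasurableSpace.comap (p n ∘ T) inferInstance := by
      intro i j hij
      simpa only [← MeasurableSpace.comap_comp] using MeasurableSpace.comap_mono (hmono hij)
    simpa only [hsupT] using tendsto_condPartitionEntropy_iSup (μ := μ) hmonoT
      (fun n => ((hp n).comp hT.measurable).comap_le) hw
  have hf_lim : Tendsto (fun n => condPartitionEntropy μ
      (MeasurableSpace.comap (p n) inferInstance) f) atTop (𝓝 0) := by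
    simpa only [hsup, condPartitionEntropy_eq_zero le_rfl hf] using
      tendsto_condPartitionEntropy_iSup (μ := μ) hmono (fun n => (hp n).comap_le) hf
  have hlim := hw_lim.add hf_lim
  rw [add_zero] at hlim
  exact ge_of_tendsto' ((continuous_coe_real_ereal.tendsto _).comp hlim) fun n =>
    entropyOfPartition_le_add hT hf (hp n) hw (h n)

end Entropy

section CellularAutomaton

lemma restrict_eq_restrict_iff {ι α : Type*} {s : Finset ι} {f g : ι → α} :
    s.restrict f = s.restrict g ↔ Set.EqOn f g s :=
  Set.domRestrict_eq_domRestrict_iff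

variable {A : Type*} {ℓ r : ℕ} {φ : (Fin (ℓ + r + 1) → A) → A} {x y : ℤ → A}

lemma ofLocalRule_apply_eq_snoc (x : ℤ → A) (z : ℤ) :
    ofLocalRule ℓ r φ x z =
      φ (Fin.snoc (α := fun _ => A) (fun i : Fin (ℓ + r) => x (z - ℓ + (i : ℕ))) (x (z + r))) := by
  refine congrArg φ (funext fun i => ?_)
  cases i using Fin.lastCases with
  | last => rw [Fin.snoc_last, Fin.val_last]; congr 1; push_cast; ring
  | cast i => rw [Fin.snoc_castSucc, Fin.val_castSucc]

lemma ofLocalRule_apply_eq_cons (x : ℤ → A) (z : ℤ) :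
    ofLocalRule ℓ r φ x z =
      φ (Fin.cons (α := fun _ => A) (x (z - ℓ))
        fun i : Fin (ℓ + r) => x (z - ℓ + ((i : ℕ) + 1))) := by
  refine congrArg φ (funext fun i => ?_)
  cases i using Fin.cases with
  | zero => rw [Fin.cons_zero, Fin.val_zero, Nat.cast_zero, add_zero]
  | succ i => rw [Fin.cons_succ, Fin.val_succ, Nat.cast_add, Nat.cast_one]

lemma RightPermutative.eq_of_eqOn_Ico (hφ : RightPermutative φ) {z : ℤ}
    (h : Set.EqOn x y (Set.Ico (z - ℓ) (z + r)))
    (hz : ofLocalRule ℓ r φ x z = ofLocalRule ℓ r φ y z) : x (z + r) = y (z + r) := by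
  have hxy : (fun i : Fin (ℓ + r) => x (z - ℓ + (i : ℕ))) =
      fun i : Fin (ℓ + r) => y (z - ℓ + (i : ℕ)) :=
    funext fun i => h ⟨by omega, by omega⟩
  rw [ofLocalRule_apply_eq_snoc, ofLocalRule_apply_eq_snoc, hxy] at hz
  exact (hφ _).injective hz

lemma LeftPermutative.eq_of_eqOn_Ioc (hφ : LeftPermutative φ) {z : ℤ}
    (h : Set.EqOn x y (Set.Ioc (z - ℓ) (z + r)))
    (hz : ofLocalRule ℓ r φ x z = ofLocalRule ℓ r φ y z) : x (z - ℓ) = y (z - ℓ) := by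
  have hxy : (fun i : Fin (ℓ + r) => x (z - ℓ + ((i : ℕ) + 1))) =
      fun i : Fin (ℓ + r) => y (z - ℓ + ((i : ℕ) + 1)) :=
    funext fun i => h ⟨by omega, by omega⟩
  rw [ofLocalRule_apply_eq_cons, ofLocalRule_apply_eq_cons, hxy] at hz
  exact (hφ _).injective hz

lemma RightPermutative.eqOn_Ico (hφ : RightPermutative φ) {b c : ℤ} (hcb : c ≤ b)
    (hw : Set.EqOn x y (Set.Ico (c - ℓ) (c + r)))
    (h : Set.EqOn (ofLocalRule ℓ r φ x) (ofLocalRule ℓ r φ y) (Set.Ico c b)) :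
    Set.EqOn x y (Set.Ico (c - ℓ) (b + r)) := by
  induction b, hcb using Int.leInduction with
  | base => exact hw
  | succ b hcb ih =>
    have hb := ih (h.mono (Set.Ico_subset_Ico_right (by omega)))
    rintro z ⟨hz₁, hz₂⟩
    obtain hz | rfl : z < b + r ∨ z = b + r := by omega
    · exact hb ⟨hz₁, hz⟩
    · exact hφ.eq_of_eqOn_Ico (hb.mono (Set.Ico_subset_Ico_left (by omega)))
        (h ⟨hcb, by omega⟩)

lemma LeftPermutative.eqOn_Ico (hφ : LeftPermutative φ) {a c : ℤ} (hac : a ≤ c)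
    (hw : Set.EqOn x y (Set.Ico (c - ℓ) (c + r)))
    (h : Set.EqOn (ofLocalRule ℓ r φ x) (ofLocalRule ℓ r φ y) (Set.Ico a c)) :
    Set.EqOn x y (Set.Ico (a - ℓ) (c + r)) := by
  induction a, hac using Int.leInductionDown with
  | base => exact hw
  | pred a hac ih =>
    have ha := ih (h.mono (Set.Ico_subset_Ico_left (by omega)))
    rintro z ⟨hz₁, hz₂⟩
    obtain hz | rfl : a - ℓ ≤ z ∨ z = a - 1 - ℓ := by omega
    · exact ha ⟨hz, hz₂⟩
    · refine hφ.eq_of_eqOn_Ioc (ha.mono fun t ht => ?_) (h ⟨by omega, by omega⟩)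
      rw [Set.mem_Ioc] at ht
      exact ⟨by omega, by omega⟩

lemma eqOn_Ico_of_bipermutative (hL : LeftPermutative φ) (hR : RightPermutative φ) {a b : ℤ}
    (ha : a ≤ 0) (hb : 0 ≤ b) (hw : Set.EqOn x y (Set.Ico (-ℓ) r))
    (h : Set.EqOn (ofLocalRule ℓ r φ x) (ofLocalRule ℓ r φ y) (Set.Ico a b)) :
    Set.EqOn x y (Set.Ico (a - ℓ) (b + r)) := by
  have hw₀ : Set.EqOn x y (Set.Ico (0 - ℓ) (0 + r)) := by rwa [zero_sub, zero_add]
  have hleft := hL.eqOn_Ico ha hw₀ (h.mono (Set.Ico_subset_Ico_right hb))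
  have hright := hR.eqOn_Ico hb hw₀ (h.mono (Set.Ico_subset_Ico_left ha))
  exact (hleft.union hright).mono fun z ⟨hz₁, hz₂⟩ =>
    (lt_or_ge z (0 + r)).imp (⟨hz₁, ·⟩) fun hz => ⟨by omega, hz₂⟩

lemma restrict_Ico_factorsThrough (hL : LeftPermutative φ) (hR : RightPermutative φ) (n : ℕ) :
    (Finset.Ico (-n : ℤ) n).restrict.FactorsThrough fun x : ℤ → A =>
      ((Finset.Ico (-n : ℤ) n).restrict (ofLocalRule ℓ r φ x),
        (Finset.Ico (-ℓ : ℤ) r).restrict x) := by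
  intro x y hxy
  rw [Prod.mk.injEq, restrict_eq_restrict_iff, restrict_eq_restrict_iff, Finset.coe_Ico,
    Finset.coe_Ico] at hxy
  rw [restrict_eq_restrict_iff, Finset.coe_Ico]
  exact (eqOn_Ico_of_bipermutative hL hR (by omega) (by omega) hxy.2 hxy.1).mono
    (Set.Ico_subset_Ico (by omega) (by omega))

lemma injOn_restrict_Ico (hL : LeftPermutative φ) (hR : RightPermutative φ) (u : ℤ → A) :
    Set.InjOn (Finset.Ico (-ℓ : ℤ) r).restrict (ofLocalRule ℓ r φ ⁻¹' {u}) := by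
  intro x hx y hy hxy
  ext z
  refine congrFun (restrict_Ico_factorsThrough hL hR (z.natAbs + 1) (Prod.ext ?_ hxy)) ⟨z, ?_⟩
  · exact congrArg (Finset.restrict _) (hx.trans hy.symm)
  · rw [Finset.mem_Ico]; omega

lemma finite_ker_of_bipermutative [Finite A] [Group (ℤ → A)] {Φ : (ℤ → A) →* (ℤ → A)}
    (hΦ : ⇑Φ = ofLocalRule ℓ r φ) (hL : LeftPermutative φ) (hR : RightPermutative φ) :
    Finite Φ.ker :=
  Set.Finite.of_finite_image (Set.toFinite _) <|
    (injOn_restrict_Ico hL hR 1).mono fun _ hx => (congrFun hΦ _).symm.trans hx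

lemma continuous_ofLocalRule [TopologicalSpace A] [DiscreteTopology A] :
    Continuous (ofLocalRule ℓ r φ) :=
  continuous_pi fun _ => (continuous_of_discreteTopology (f := φ)).comp
    (continuous_pi fun _ => continuous_apply _)

lemma shift_injective : Function.Injective (shift : (ℤ → A) → ℤ → A) :=
  (Equiv.subRight (1 : ℤ)).surjective.injective_comp_right

lemma commute_shift_ofLocalRule : Function.Commute shift (ofLocalRule ℓ r φ) := fun x =>
  funext fun z => congrArg φ <| funext fun i => congrArg x <| by ring

lemma monotone_comap_restrict_Ico [MeasurableSpace A] :
    Monotone fun n : ℕ => MeasurableSpace.comap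
      ((Finset.Ico (-n : ℤ) n).restrict : (ℤ → A) → _) inferInstance := by
  intro m n hmn
  have hsub : Finset.Ico (-m : ℤ) m ⊆ Finset.Ico (-n : ℤ) n :=
    Finset.Ico_subset_Ico (by omega) (by omega)
  dsimp only
  rw [← Finset.restrict₂_comp_restrict hsub, ← MeasurableSpace.comap_comp]
  exact MeasurableSpace.comap_mono (Finset.measurable_restrict₂ hsub).comap_le

lemma iSup_comap_restrict_Ico [MeasurableSpace A] :
    ⨆ n : ℕ, MeasurableSpace.comap
      ((Finset.Ico (-n : ℤ) n).restrict : (ℤ → A) → _) inferInstance = MeasurableSpace.pi := by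
  refine le_antisymm (iSup_le fun n => (Finset.measurable_restrict _).comap_le)
    (iSup_le fun z => ?_)
  obtain ⟨n, hz⟩ : ∃ n : ℕ, z ∈ Finset.Ico (-n : ℤ) n :=
    ⟨z.natAbs + 1, by rw [Finset.mem_Ico]; omega⟩
  let p : (ℤ → A) → Finset.Ico (-n : ℤ) n → A := (Finset.Ico (-n : ℤ) n).restrict
  have heval : Measurable[MeasurableSpace.comap p inferInstance] fun x : ℤ → A => x z :=
    (measurable_pi_apply (⟨z, hz⟩ : Finset.Ico (-n : ℤ) n)).comp (comap_measurable p)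
  exact le_iSup_of_le n heval.comap_le

lemma entropy_ofLocalRule [Fintype A] [MeasurableSpace A] [MeasurableSingletonClass A]
    {μ : Measure (ℤ → A)} [IsProbabilityMeasure μ] (hL : LeftPermutative φ)
    (hR : RightPermutative φ) (hμ : MeasurePreserving (ofLocalRule ℓ r φ) μ μ) :
    entropy (ofLocalRule ℓ r φ) μ = (condPartitionEntropy μ
      (MeasurableSpace.comap (ofLocalRule ℓ r φ) MeasurableSpace.pi)
      (Finset.Ico (-ℓ : ℤ) r).restrict : ℝ) :=
  entropy_eq_condPartitionEntropy_comap hμ (fun _ => Finset.measurable_restrict _)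
    monotone_comap_restrict_Ico iSup_comap_restrict_Ico (Finset.measurable_restrict _)
    (restrict_Ico_factorsThrough hL hR)

end CellularAutomaton

section UniformOn

variable {Ω : Type*} [MeasurableSpace Ω] [MeasurableSingletonClass Ω] {s : Set Ω}

lemma uniformOn_real_apply (hs : s.Finite) (t : Set Ω) :
    (uniformOn s).real t = (s ∩ t).ncard / s.ncard := by
  have hst := hs.inter_of_left t
  rw [uniformOn, measureReal_def, cond_apply hs.measurableSet, Measure.count_apply_finite s hs,
    Measure.count_apply_finite _ hst, ENNReal.toReal_mul, ENNReal.toReal_inv,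
    ENNReal.toReal_natCast, ENNReal.toReal_natCast, ← Set.ncard_eq_toFinset_card s hs,
    ← Set.ncard_eq_toFinset_card _ hst, inv_mul_eq_div]

lemma uniformOn_singleton_pos_iff (hs : s.Finite) {y : Ω} : 0 < uniformOn s {y} ↔ y ∈ s := by
  rw [pos_iff_ne_zero, ne_eq, uniformOn_eq_zero_iff hs, Set.inter_singleton_eq_empty, not_not]

lemma support_uniformOn [TopologicalSpace Ω] [T1Space Ω] (hs : s.Finite) :
    (uniformOn s).support = s := by
  ext y
  simp only [Measure.mem_support_iff_forall, pos_iff_ne_zero, ne_eq, uniformOn_eq_zero_iff hs,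
    ← Set.nonempty_iff_ne_empty, Set.inter_comm s, ← mem_closure_iff_nhds,
    hs.isClosed.closure_eq]

lemma partitionEntropy_uniformOn {ι : Type*} [Fintype ι] (hs : s.Finite) {g : Ω → ι}
    (hg : Set.InjOn g s) : partitionEntropy (uniformOn s) g = Real.log s.ncard := by
  classical
  lift s to Finset Ω using hs
  have hmem : ∀ y ∈ s,
      Real.negMulLog ((uniformOn (s : Set Ω)).real (g ⁻¹' {g y})) = Real.log s.card / s.card := by
    intro y hy
    have hfib : (s : Set Ω) ∩ g ⁻¹' {g y} = {y} :=
      Set.eq_singleton_iff_unique_mem.2 ⟨⟨hy, rfl⟩, fun z hz => hg hz.1 hy hz.2⟩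
    rw [uniformOn_real_apply s.finite_toSet, hfib, Set.ncard_singleton, Set.ncard_coe_finset,
      Nat.cast_one, Real.negMulLog, one_div, Real.log_inv]
    ring
  have hnotMem : ∀ i ∉ s.image g,
      Real.negMulLog ((uniformOn (s : Set Ω)).real (g ⁻¹' {i})) = 0 := by
    intro i hi
    have hfib : (s : Set Ω) ∩ g ⁻¹' {i} = ∅ :=
      Set.eq_empty_of_forall_notMem fun z hz => hi (Finset.mem_image.2 ⟨z, hz⟩)
    rw [uniformOn_real_apply s.finite_toSet, hfib, Set.ncard_empty, Nat.cast_zero, zero_div,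
      Real.negMulLog_zero]
  rw [partitionEntropy, ← Finset.sum_subset (Finset.subset_univ (s.image g)) fun i _ => hnotMem i,
    Finset.sum_image hg, Finset.sum_congr rfl hmem, Finset.sum_const, nsmul_eq_mul,
    Set.ncard_coe_finset]
  rcases s.eq_empty_or_nonempty with rfl | hs
  · simp
  · exact mul_div_cancel₀ _ (Nat.cast_ne_zero.2 hs.card_ne_zero)

end UniformOn

lemma eq_or_mutuallySingular_of_ergodic {X : Type*} [MeasurableSpace X] {T : X → X}
    {μ ν : Measure X} [IsProbabilityMeasure μ] [IsProbabilityMeasure ν] (hμ : Ergodic T μ)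
    (hν : Ergodic T ν) : ν = μ ∨ ν ⟂ₘ μ := by
  obtain ⟨c, hc⟩ := hν.eq_smul_of_absolutelyContinuous
    (hν.toMeasurePreserving.singularPart hμ.toMeasurePreserving)
    (Measure.singularPart_le ν μ).absolutelyContinuous
  rcases eq_or_ne c 0 with rfl | hc0
  · rw [zero_smul, Measure.singularPart_eq_zero] at hc
    exact Or.inl (hμ.eq_of_absolutelyContinuous hν.toMeasurePreserving hc)
  · have hsing := Measure.mutuallySingular_singularPart ν μ
    rw [hc] at hsing
    exact Or.inr (hsing.mono_ac (Measure.absolutelyContinuous_smul hc0) .rfl)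

section RightStabilizer

variable {G : Type*} [Group G] [MeasurableSpace G] [MeasurableMul G] {μ : Measure G} {k : G}

/-- The subgroup of those `k` whose right translation `x ↦ x * k` preserves `μ`. -/
def rightStabilizer (μ : Measure G) : Subgroup G where
  carrier := {k | MeasurePreserving (· * k) μ μ}
  one_mem' := by
    simp only [Set.mem_ofPred_eq, mul_one]
    exact MeasurePreserving.id μ
  mul_mem' {a b} ha hb := by
    simpa only [Set.mem_ofPred_eq, Function.comp_def, mul_assoc] using hb.comp ha
  inv_mem' {a} ha := ha.symm (MeasurableEquiv.mulRight a)

lemma mem_rightStabilizer : k ∈ rightStabilizer μ ↔ MeasurePreserving (· * k) μ μ := Iff.rfl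

lemma map_mem_rightStabilizer_iff {f : G →* G} (hf : MeasurableEmbedding f)
    (hfμ : MeasurePreserving f μ μ) : f k ∈ rightStabilizer μ ↔ k ∈ rightStabilizer μ := by
  have hmap : μ.map (· * f k) = (μ.map (· * k)).map f := by
    conv_lhs => rw [← hfμ.map_eq]
    rw [Measure.map_map (measurable_mul_const _) hfμ.measurable,
      Measure.map_map hfμ.measurable (measurable_mul_const k)]
    exact congrArg (Measure.map · μ) (funext fun x => (map_mul f x k).symm)
  have hmem (k : G) : k ∈ rightStabilizer μ ↔ μ.map (· * k) = μ :=
    ⟨fun h => h.map_eq, fun h => ⟨measurable_mul_const k, h⟩⟩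
  rw [hmem, hmem, hmap, ← hf.map_injective.eq_iff (a := μ.map (· * k)), hfμ.map_eq]

lemma mutuallySingular_map_mul_right [IsProbabilityMeasure μ] {S : G →* G} (hS : Ergodic S μ)
    (hk : S k = k) (hkμ : k ∉ rightStabilizer μ) : μ.map (· * k) ⟂ₘ μ := by
  have hmap : MeasurePreserving (· * k) μ (μ.map (· * k)) := ⟨measurable_mul_const k, rfl⟩
  have := Measure.isProbabilityMeasure_map (μ := μ) hmap.measurable.aemeasurable
  have hSk : Ergodic S (μ.map (· * k)) :=
    hmap.ergodic_of_ergodic_semiconj hS hS.measurable fun x => by simp only [map_mul, hk]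
  exact (eq_or_mutuallySingular_of_ergodic hS hSk).resolve_left fun h => hkμ ⟨hmap.measurable, h⟩

lemma exists_measurableSet_forall_mul_mem_iff {K : Set G} (hK : K.Countable)
    (hsing : ∀ k ∈ K, k ∉ rightStabilizer μ → μ.map (· * k) ⟂ₘ μ) :
    ∃ U, MeasurableSet U ∧ ∀ᵐ x ∂μ, ∀ k ∈ K, x * k ∈ U ↔ k ∈ rightStabilizer μ := by
  have : Countable ↥(K \ rightStabilizer μ) := (hK.mono Set.sdiff_subset).to_subtype
  have hsum : Measure.sum (fun k : ↥(K \ rightStabilizer μ) => μ.map (· * (k : G))) ⟂ₘ μ :=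
    Measure.MutuallySingular.sum_left.2 fun k => hsing k k.2.1 k.2.2
  obtain ⟨U, hU, hU_sum, hU_compl⟩ := hsum
  refine ⟨U, hU, (ae_ball_iff hK).2 fun k hk => ?_⟩
  by_cases hkμ : k ∈ rightStabilizer μ
  · filter_upwards [(mem_rightStabilizer.1 hkμ).quasiMeasurePreserving.ae
      (mem_ae_iff.2 hU_compl)] with x hx
    exact iff_of_true hx hkμ
  · have hkU : μ ((· * k) ⁻¹' U) = 0 := by
      rw [← Measure.map_apply (measurable_mul_const k) hU]
      exact Measure.sum_apply_eq_zero.1 hU_sum ⟨k, hk, hkμ⟩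
    filter_upwards [measure_eq_zero_iff_ae_notMem.1 hkU] with x hx
    exact iff_of_false hx hkμ

end RightStabilizer

lemma measurable_comap_comp {X Y Z : Type*} [MeasurableSpace X] [StandardBorelSpace X]
    [MeasurableSpace Y] [MeasurableSpace Z] {f : X → Y} {g : Y → Z}
    [MeasurableSpace.CountablySeparated (Set.range f)] (hf : Measurable f)
    (hr : MeasurableSet (Set.range f)) (hgf : Measurable (g ∘ f)) :
    Measurable[MeasurableSpace.comap f inferInstance] (g ∘ f) := fun s hs =>
  ⟨g ⁻¹' s ∩ Set.range f, (hf.measurableSet_preimage_iff_inter_range hr).1 (hgf hs),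
    Set.preimage_inter_range⟩

lemma ae_of_ae_comp {X Y : Type*} [MeasurableSpace X] [StandardBorelSpace X]
    [MeasurableSpace Y] {μ : Measure X} {ν : Measure Y} {f : X → Y}
    [MeasurableSpace.CountablySeparated (Set.range f)] (hf : MeasurePreserving f μ ν)
    (hr : MeasurableSet (Set.range f)) {p : Y → Prop} (hp : MeasurableSet {x | p (f x)})
    (h : ∀ᵐ x ∂μ, p (f x)) : ∀ᵐ y ∂ν, p y := by
  have hmeas : MeasurableSet ({y | p y} ∩ Set.range f) :=
    (hf.measurable.measurableSet_preimage_iff_inter_range hr).1 hp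
  rw [← hf.map_eq]
  filter_upwards [(ae_map_iff hf.measurable.aemeasurable hmeas).2
    (h.mono fun x hx => ⟨hx, Set.mem_range_self x⟩)] with y hy using hy.1

lemma ae_eq_of_forall_measurableSet {X Y : Type*} [MeasurableSpace X] {mY : MeasurableSpace Y}
    [MeasurableSpace.CountablyGenerated Y] {μ : Measure X} {κ ν : X → Measure Y}
    [∀ x, IsFiniteMeasure (κ x)]
    (h : ∀ s, MeasurableSet s → ∀ᵐ x ∂μ, κ x s = ν x s) : κ =ᵐ[μ] ν := by
  let C := generateSetAlgebra (MeasurableSpace.countableGeneratingSet Y)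
  have hC : C.Countable :=
    countable_generateSetAlgebra (MeasurableSpace.countable_countableGeneratingSet)
  have hgen : mY = MeasurableSpace.generateFrom C := by
    rw [generateFrom_generateSetAlgebra_eq,
      MeasurableSpace.generateFrom_countableGeneratingSet]
  have hpi : IsPiSystem C := fun s hs t ht _ =>
    isSetAlgebra_generateSetAlgebra.inter_mem hs ht
  have hmeas : ∀ s ∈ C, MeasurableSet s := fun s hs =>
    hgen ▸ MeasurableSpace.measurableSet_generateFrom hs
  filter_upwards [(ae_ball_iff hC).2 fun s hs => h s (hmeas s hs), h _ .univ] with x hx huniv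
  exact ext_of_generate_finite C hgen hpi hx huniv

lemma fibreMeasure_congr {X : Type*} [MeasurableSpace X] [StandardBorelSpace X] {Φ : X → X}
    {μ : Measure X} [IsFiniteMeasure μ] {x y : X} (h : Φ x = Φ y) :
    fibreMeasure Φ μ x = fibreMeasure Φ μ y :=
  Measure.ext fun _ hs => (measurable_condExpKernel hs).factorsThrough h

section Translates

variable {G : Type*} [Group G] {s : Set G}

open Classical in
lemma natCast_ncard_smul_inter [Fintype s] (x : G) (D : Set G) :
    ((x • s ∩ D).ncard : ℝ) = ∑ k : s, D.indicator 1 (x * k) := by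
  have himage : x • s ∩ D = (Finset.univ.filter fun k : s => x * k ∈ D).map
      ⟨fun k : s => x * k, fun _ _ h => Subtype.ext (mul_left_cancel h)⟩ := by
    ext y
    simp only [Finset.coe_map, Set.mem_inter_iff, Set.mem_smul_set, smul_eq_mul, Set.mem_image,
      Finset.coe_filter, Finset.mem_univ, true_and]
    constructor
    · rintro ⟨⟨k, hk, rfl⟩, hD⟩
      exact ⟨⟨k, hk⟩, hD, rfl⟩
    · rintro ⟨k, hD, rfl⟩
      exact ⟨⟨k, k.2, rfl⟩, hD⟩
  rw [himage, Set.ncard_coe_finset, Finset.card_map, Finset.natCast_card_filter]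
  rfl

variable [MeasurableSpace G] [MeasurableMul G]

lemma measurable_ncard_smul_inter (hs : s.Finite) {D : Set G} (hD : MeasurableSet D) :
    Measurable fun x : G => ((x • s ∩ D).ncard : ℝ) := by
  have := hs.fintype
  simp only [natCast_ncard_smul_inter]
  exact Finset.measurable_fun_sum _ fun k _ =>
    (measurable_one.indicator hD).comp (measurable_mul_const (k : G))

lemma integrable_ncard_smul_inter {μ : Measure G} [IsFiniteMeasure μ] (hs : s.Finite) {D : Set G}
    (hD : MeasurableSet D) : Integrable (fun x : G => ((x • s ∩ D).ncard : ℝ)) μ := by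
  refine .of_bound (measurable_ncard_smul_inter hs hD).aestronglyMeasurable s.ncard
    (ae_of_all _ fun x => ?_)
  rw [Real.norm_natCast, Nat.cast_le, ← Set.ncard_smul_set x s]
  exact Set.ncard_le_ncard Set.inter_subset_left hs.smul_set

lemma integral_ncard_smul_inter {μ : Measure G} [IsFiniteMeasure μ] (hs : s.Finite)
    (hsμ : s ⊆ rightStabilizer μ) {D : Set G} (hD : MeasurableSet D) :
    ∫ x, ((x • s ∩ D).ncard : ℝ) ∂μ = s.ncard * μ.real D := by
  have := hs.fintype
  have hμ (k : s) : MeasurePreserving (· * (k : G)) μ μ := hsμ k.2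
  have hint : Integrable (D.indicator (1 : G → ℝ)) μ := (integrable_const 1).indicator hD
  have hintegrable (k : s) : Integrable (fun x => D.indicator (1 : G → ℝ) (x * k)) μ :=
    (hμ k).integrable_comp_of_integrable hint
  have hterm (k : s) : ∫ x, D.indicator (1 : G → ℝ) (x * k) ∂μ = μ.real D := by
    rw [(hμ k).integral_comp (MeasurableEquiv.mulRight (k : G)).measurableEmbedding,
      integral_indicator_one hD]
  simp only [natCast_ncard_smul_inter]
  rw [integral_finsetSum _ fun k _ => hintegrable k]
  simp only [hterm]
  rw [Finset.sum_const, nsmul_eq_mul, Finset.card_univ, ← Nat.card_eq_fintype_card,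
    Nat.card_coe_set_eq]

end Translates

section Fibres

lemma condPartitionEntropy_comap_eq_integral {X ι : Type*} [MeasurableSpace X]
    [StandardBorelSpace X] [Fintype ι] [MeasurableSpace ι] [MeasurableSingletonClass ι]
    {Φ : X → X} (hΦ : Measurable Φ) (μ : Measure X) [IsFiniteMeasure μ] {g : X → ι}
    (hg : Measurable g) :
    condPartitionEntropy μ (MeasurableSpace.comap Φ inferInstance) g =
      ∫ x, partitionEntropy (fibreMeasure Φ μ x) g ∂μ := by
  refine integral_congr_ae ?_
  have hcond (i : ι) := condExpKernel_ae_eq_condExp (μ := μ) hΦ.comap_le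
    (hg (measurableSet_singleton i))
  filter_upwards [ae_all_iff.2 hcond] with x hx
  exact Finset.sum_congr rfl fun i _ => congrArg Real.negMulLog (hx i).symm

lemma fibreAtoms_eq_of_fibreMeasure_eq_uniformOn {X : Type*} [MeasurableSpace X]
    [StandardBorelSpace X] {Φ : X → X} {μ : Measure X} [IsFiniteMeasure μ] {x : X} {s : Set X}
    (hs : s.Finite) (hsub : s ⊆ Φ ⁻¹' {Φ x}) (h : fibreMeasure Φ μ x = uniformOn s) :
    fibreAtoms Φ μ x = s := by
  ext y
  constructor
  · rintro ⟨hy, hpos⟩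
    rwa [fibreMeasure_congr hy, h, uniformOn_singleton_pos_iff hs] at hpos
  · intro hy
    refine ⟨hsub hy, ?_⟩
    rwa [fibreMeasure_congr (hsub hy), h, uniformOn_singleton_pos_iff hs]

lemma preimage_singleton_eq_smul_ker {G H : Type*} [Group G] [Group H] (Φ : G →* H) (x : G) :
    Φ ⁻¹' {Φ x} = x • (Φ.ker : Set G) := by
  ext y
  rw [Set.mem_smul_set_iff_inv_smul_mem, smul_eq_mul, SetLike.mem_coe, ← MonoidHom.eq_iff]
  rfl

lemma smul_subset_preimage_singleton {G H : Type*} [Group G] [Group H] {Φ : G →* H} {s : Set G}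
    (hs : s ⊆ Φ.ker) (x : G) : x • s ⊆ Φ ⁻¹' {Φ x} :=
  preimage_singleton_eq_smul_ker Φ x ▸ Set.smul_set_mono hs

end Fibres

section FiniteKernel

variable {G : Type*} [Group G] [MeasurableSpace G] [MeasurableMul G] {Φ : G →* G}
  {μ : Measure G}

lemma exists_measurableSet_inter_preimage_ae_eq_smul (hker : (Φ.ker : Set G).Countable)
    (hsing : ∀ k ∈ Φ.ker, k ∉ rightStabilizer μ → μ.map (· * k) ⟂ₘ μ) :
    ∃ U, MeasurableSet U ∧
      ∀ᵐ x ∂μ, U ∩ Φ ⁻¹' {Φ x} = x • ((Φ.ker ⊓ rightStabilizer μ : Subgroup G) : Set G) := by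
  obtain ⟨U, hU, hUμ⟩ := exists_measurableSet_forall_mul_mem_iff hker hsing
  refine ⟨U, hU, hUμ.mono fun x hx => ?_⟩
  rw [preimage_singleton_eq_smul_ker]
  ext y
  constructor
  · rintro ⟨hyU, k, hk, rfl⟩
    exact ⟨k, ⟨hk, (hx k hk).1 hyU⟩, rfl⟩
  · rintro ⟨k, ⟨hk, hkμ⟩, rfl⟩
    exact ⟨(hx k hk).2 hkμ, k, hk, rfl⟩

lemma setIntegral_ncard_smul_inter [IsFiniteMeasure μ] {s : Set G} (hs : s.Finite)
    (hsub : s ⊆ (Φ.ker ⊓ rightStabilizer μ : Subgroup G)) (hΦ : Measurable Φ) {t C : Set G}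
    (ht : MeasurableSet t) (hC : MeasurableSet C) :
    ∫ x in Φ ⁻¹' t, ((x • s ∩ C).ncard : ℝ) ∂μ = s.ncard * μ.real (Φ ⁻¹' t ∩ C) := by
  rw [← integral_ncard_smul_inter hs (fun _ hk => (hsub hk).2) ((hΦ ht).inter hC),
    ← integral_indicator (hΦ ht)]
  refine integral_congr_ae (ae_of_all _ fun x => ?_)
  have hconst : ∀ y ∈ x • s, Φ y = Φ x :=
    smul_subset_preimage_singleton (fun _ hk => (hsub hk).1) x
  by_cases hx : x ∈ Φ ⁻¹' t
  · have hinter : x • s ∩ (Φ ⁻¹' t ∩ C) = x • s ∩ C := by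
      have hsub_t : x • s ⊆ Φ ⁻¹' t := fun y hy => by rwa [Set.mem_preimage, hconst y hy]
      rw [← Set.inter_assoc, Set.inter_eq_left.2 hsub_t]
    simp only [Set.indicator_of_mem hx, hinter]
  · have hinter : x • s ∩ (Φ ⁻¹' t ∩ C) = ∅ :=
      Set.eq_empty_of_forall_notMem fun y hy => hx <| by
        rw [Set.mem_preimage, ← hconst y hy.1]
        exact hy.2.1
    simp only [Set.indicator_of_notMem hx, hinter, Set.ncard_empty, Nat.cast_zero]

variable [StandardBorelSpace G] [Finite Φ.ker]

lemma measurable_ncard_inter_preimage_singleton (hΦ : Measurable Φ)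
    (hr : MeasurableSet (Set.range Φ)) {D : Set G} (hD : MeasurableSet D) :
    Measurable[MeasurableSpace.comap Φ inferInstance]
      fun x => ((D ∩ Φ ⁻¹' {Φ x}).ncard : ℝ) := by
  refine measurable_comap_comp (g := fun u => ((D ∩ Φ ⁻¹' {u}).ncard : ℝ)) hΦ hr ?_
  simpa only [Function.comp_def, preimage_singleton_eq_smul_ker, Set.inter_comm D] using
    measurable_ncard_smul_inter (Set.toFinite (Φ.ker : Set G)) hD

variable {J : Subgroup G} {U : Set G}

lemma condExp_comap_ae_eq_uniformOn_smul [IsFiniteMeasure μ] (hΦ : Measurable Φ)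
    (hr : MeasurableSet (Set.range Φ)) (hJ : J ≤ Φ.ker ⊓ rightStabilizer μ)
    (hU : MeasurableSet U) (hUJ : ∀ᵐ x ∂μ, U ∩ Φ ⁻¹' {Φ x} = x • (J : Set G)) {C : Set G}
    (hC : MeasurableSet C) :
    (fun x => (uniformOn (x • (J : Set G))).real C) =ᵐ[μ]
      μ⟦C | MeasurableSpace.comap Φ inferInstance⟧ := by
  have hJfin : (J : Set G).Finite :=
    (Set.toFinite (Φ.ker : Set G)).subset fun _ hk => (hJ hk).1
  have hJcard : ((J : Set G).ncard : ℝ) ≠ 0 :=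
    Nat.cast_ne_zero.2 (Set.ncard_ne_zero_of_mem J.one_mem hJfin)
  have happly (x : G) : (uniformOn (x • (J : Set G))).real C =
      (x • (J : Set G) ∩ C).ncard / (J : Set G).ncard := by
    rw [uniformOn_real_apply hJfin.smul_set, Set.ncard_smul_set]
  simp only [happly]
  refine ae_eq_condExp_of_forall_setIntegral_eq hΦ.comap_le ((integrable_const 1).indicator hC)
    (fun _ _ _ => ((integrable_ncard_smul_inter hJfin hC).div_const _).integrableOn) ?_ ?_
  · rintro _ ⟨t, ht, rfl⟩ _
    rw [integral_div, setIntegral_ncard_smul_inter hJfin hJ hΦ ht hC,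
      mul_div_cancel_left₀ _ hJcard, setIntegral_indicator hC, setIntegral_const, smul_eq_mul,
      mul_one]
  · refine ⟨fun x => ((U ∩ C) ∩ Φ ⁻¹' {Φ x}).ncard / (J : Set G).ncard,
      ((measurable_ncard_inter_preimage_singleton hΦ hr (hU.inter hC)).div_const
        _).stronglyMeasurable, ?_⟩
    filter_upwards [hUJ] with x hx
    rw [Set.inter_right_comm, hx]

lemma fibreMeasure_ae_eq_uniformOn_smul [IsFiniteMeasure μ] (hΦ : Measurable Φ)
    (hr : MeasurableSet (Set.range Φ)) (hJ : J ≤ Φ.ker ⊓ rightStabilizer μ)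
    (hU : MeasurableSet U) (hUJ : ∀ᵐ x ∂μ, U ∩ Φ ⁻¹' {Φ x} = x • (J : Set G)) :
    fibreMeasure Φ μ =ᵐ[μ] fun x => uniformOn (x • (J : Set G)) := by
  have hfin (x : G) : IsFiniteMeasure (fibreMeasure Φ μ x) := by
    unfold fibreMeasure; infer_instance
  refine ae_eq_of_forall_measurableSet fun C hC => ?_
  filter_upwards [condExpKernel_ae_eq_condExp hΦ.comap_le hC,
    condExp_comap_ae_eq_uniformOn_smul hΦ hr hJ hU hUJ hC] with x hx hxJ
  rw [← measureReal_eq_measureReal_iff]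
  exact hx.trans hxJ.symm

lemma fibreAtoms_ae_eq_smul_and_support_ae_eq_smul [TopologicalSpace G] [T1Space G]
    [IsFiniteMeasure μ] (hΦ : Measurable Φ) (hr : MeasurableSet (Set.range Φ))
    (hJ : J ≤ Φ.ker ⊓ rightStabilizer μ) (hU : MeasurableSet U)
    (hUJ : ∀ᵐ x ∂μ, U ∩ Φ ⁻¹' {Φ x} = x • (J : Set G)) :
    ∀ᵐ x ∂μ, fibreAtoms Φ μ x = x • (J : Set G) ∧
      (fibreMeasure Φ μ x).support = x • (J : Set G) := by
  have hJker : (J : Set G) ⊆ Φ.ker := fun _ hk => (hJ hk).1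
  have hfin (x : G) : (x • (J : Set G)).Finite :=
    ((Set.toFinite (Φ.ker : Set G)).subset hJker).smul_set
  filter_upwards [fibreMeasure_ae_eq_uniformOn_smul hΦ hr hJ hU hUJ] with x hx
  exact ⟨fibreAtoms_eq_of_fibreMeasure_eq_uniformOn (hfin x)
    (smul_subset_preimage_singleton hJker x) hx, hx ▸ support_uniformOn (hfin x)⟩

lemma condPartitionEntropy_comap_eq_log_card [IsProbabilityMeasure μ] {ι : Type*} [Fintype ι]
    [MeasurableSpace ι] [MeasurableSingletonClass ι] (hΦ : Measurable Φ)
    (hr : MeasurableSet (Set.range Φ)) (hJ : J ≤ Φ.ker ⊓ rightStabilizer μ)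
    (hU : MeasurableSet U) (hUJ : ∀ᵐ x ∂μ, U ∩ Φ ⁻¹' {Φ x} = x • (J : Set G)) {g : G → ι}
    (hg : Measurable g) (hinj : ∀ u, Set.InjOn g (Φ ⁻¹' {u})) :
    condPartitionEntropy μ (MeasurableSpace.comap Φ inferInstance) g = Real.log (Nat.card J) := by
  have hJker : (J : Set G) ⊆ Φ.ker := fun _ hk => (hJ hk).1
  have hJfin : (J : Set G).Finite := (Set.toFinite (Φ.ker : Set G)).subset hJker
  have hentropy : (fun x => partitionEntropy (fibreMeasure Φ μ x) g) =ᵐ[μ]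
      fun _ => Real.log (Nat.card J) := by
    filter_upwards [fibreMeasure_ae_eq_uniformOn_smul hΦ hr hJ hU hUJ] with x hx
    rw [hx, partitionEntropy_uniformOn hJfin.smul_set
      ((hinj (Φ x)).mono (smul_subset_preimage_singleton hJker x)), Set.ncard_smul_set]
    rfl
  rw [condPartitionEntropy_comap_eq_integral hΦ μ hg, integral_congr_ae hentropy, integral_const,
    probReal_univ, one_smul]

lemma isAEToOne_card (hμΦ : MeasurePreserving Φ μ μ) [IsProbabilityMeasure μ]
    (hr : MeasurableSet (Set.range Φ)) (hJ : J ≤ Φ.ker)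
    (hU : MeasurableSet U) (hUJ : ∀ᵐ x ∂μ, U ∩ Φ ⁻¹' {Φ x} = x • (J : Set G)) :
    IsAEToOne Φ μ (Nat.card J) := by
  have hJfin : (J : Set G).Finite := (Set.toFinite (Φ.ker : Set G)).subset hJ
  have hmem : ∀ᵐ x ∂μ, x ∈ U := hUJ.mono fun x hx =>
    (hx.ge ⟨1, J.one_mem, mul_one x⟩ : x ∈ U ∩ Φ ⁻¹' {Φ x}).1
  have hmemΦ : ∀ᵐ x ∂μ, Φ x ∈ U := hμΦ.quasiMeasurePreserving.ae hmem
  have hmeas : MeasurableSet {x | ((U ∩ Φ ⁻¹' {Φ x}).ncard : ℝ) = (J : Set G).ncard} :=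
    hμΦ.measurable.comap_le _ (measurable_ncard_inter_preimage_singleton hμΦ.measurable hr hU
      (measurableSet_singleton _))
  have hcard : ∀ᵐ u ∂μ, ((U ∩ Φ ⁻¹' {u}).ncard : ℝ) = (J : Set G).ncard :=
    ae_of_ae_comp hμΦ hr hmeas (hUJ.mono fun x hx => by rw [hx, Set.ncard_smul_set])
  refine ⟨U, hU, (prob_compl_eq_zero_iff hU).1 hmem, ?_, hcard.mono fun u hu _ => ?_⟩
  · filter_upwards [hmem, hmemΦ] with x hx hxΦ using propext (iff_of_true hxΦ hx)
  · have hne := Set.ncard_ne_zero_of_mem J.one_mem hJfin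
    rw [Nat.cast_inj] at hu
    rw [← (Set.finite_of_ncard_ne_zero (hu ▸ hne)).cast_ncard_eq, hu]
    rfl

end FiniteKernel

lemma exists_iterate_eq_self_of_finite {X : Type*} {T : X → X} {K : Set X} (hT : Set.InjOn T K)
    (hK : K.Finite) (hTK : Set.MapsTo T K K) : ∃ n, 1 ≤ n ∧ ∀ k ∈ K, T^[n] k = k := by
  have : Finite K := hK
  let e : Equiv.Perm K := Equiv.ofBijective (hTK.restrict T K K)
    (Finite.injective_iff_bijective.1 (hTK.restrict_inj.2 hT))
  refine ⟨orderOf e, orderOf_pos e, fun k hk => ?_⟩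
  have hiterate : (⇑e)^[orderOf e] = id := by
    rw [Equiv.Perm.iterate_eq_pow, pow_orderOf_eq_one, Equiv.Perm.coe_one]
  have hsemiconj : Function.Semiconj Subtype.val e T := fun _ => rfl
  have hval := congrArg Subtype.val (congrFun hiterate ⟨k, hk⟩)
  exact ((hsemiconj.iterate_right _).eq ⟨k, hk⟩).symm.trans hval

section GroupShift

variable {A : Type*} [Group (ℤ → A)]

/-- The shift of a group shift as a group endomorphism. -/
def IsGroupShift.shiftHom [TopologicalSpace A] (hA : IsGroupShift A) : Monoid.End (ℤ → A) :=
  MonoidHom.mk' shift hA.shift_mul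

lemma IsGroupShift.coe_shiftHom_pow [TopologicalSpace A] (hA : IsGroupShift A) (n : ℕ) :
    ⇑(hA.shiftHom ^ n) = shift^[n] :=
  Monoid.End.coe_pow _ hA.shiftHom n

lemma IsGroupShift.shift_mem_ker_iff [TopologicalSpace A] (hA : IsGroupShift A)
    {Φ : (ℤ → A) →* (ℤ → A)} (hΦ : Function.Commute shift Φ) {k : ℤ → A} :
    shift k ∈ Φ.ker ↔ k ∈ Φ.ker := by
  rw [MonoidHom.mem_ker, ← hΦ k, MonoidHom.mem_ker, ← shift_injective.eq_iff (a := Φ k)]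
  exact iff_of_eq (congrArg (shift (Φ k) = ·) (map_one hA.shiftHom).symm)

lemma IsGroupShift.exists_iterate_shift_eq_self [Finite A] [TopologicalSpace A]
    (hA : IsGroupShift A) {Φ : (ℤ → A) →* (ℤ → A)} (hΦ : IsBipermutativeCA Φ) :
    ∃ n, 1 ≤ n ∧ ∀ k ∈ Φ.ker, shift^[n] k = k := by
  obtain ⟨ℓ, r, φ, hφ, hL, hR⟩ := hΦ
  have := finite_ker_of_bipermutative hφ hL hR
  exact exists_iterate_eq_self_of_finite shift_injective.injOn
    (Set.toFinite (Φ.ker : Set (ℤ → A)))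
    fun _ => (hA.shift_mem_ker_iff (hφ ▸ commute_shift_ofLocalRule)).2

end GroupShift

end BipermCA

open BipermCA in
theorem mainTheorem5_general {A : Type*} [Finite A] [TopologicalSpace A] [DiscreteTopology A]
    [MeasurableSpace A] [DiscreteMeasurableSpace A] [Group (ℤ → A)]
    (hA : IsGroupShift A)
    (Φ : (ℤ → A) →* (ℤ → A)) (hΦ : IsBipermutativeCA Φ)
    (μ : Measure (ℤ → A)) [IsProbabilityMeasure μ] (hμΦ : MeasurePreserving Φ μ μ)
    (hμσ : MeasurePreserving shift μ μ) {n : ℕ} (hn : ∀ k ∈ Φ.ker, shift^[n] k = k)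
    (hμσn : Ergodic shift^[n] μ) :
    ∃ J : Subgroup (ℤ → A),
      J ≤ Φ.ker ∧
      (shift ⁻¹' (J : Set (ℤ → A)) = (J : Set (ℤ → A))) ∧
      (J : Set (ℤ → A)).Finite ∧
      (∀ᵐ x ∂μ, fibreAtoms Φ μ x = (fun j => x * j) '' (J : Set (ℤ → A)) ∧
        (fibreMeasure Φ μ x).support = (fun j => x * j) '' (J : Set (ℤ → A))) ∧
      entropy Φ μ = ((Real.log (Nat.card J) : ℝ) : EReal) ∧
      IsAEToOne Φ μ (Nat.card J) := by
  cases nonempty_fintype A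
  have := hA.isTopologicalGroup
  obtain ⟨ℓ, r, φ, hφ, hL, hR⟩ := hΦ
  have := finite_ker_of_bipermutative hφ hL hR
  have hrange : MeasurableSet (Set.range Φ) :=
    hφ ▸ (isCompact_range continuous_ofLocalRule).isClosed.measurableSet
  have hsing : ∀ k ∈ Φ.ker, k ∉ rightStabilizer μ → μ.map (· * k) ⟂ₘ μ := fun k hk =>
    mutuallySingular_map_mul_right (S := hA.shiftHom ^ n)
      (hA.coe_shiftHom_pow n ▸ hμσn) ((congrFun (hA.coe_shiftHom_pow n) k).trans (hn k hk))
  obtain ⟨U, hU, hUμ⟩ := exists_measurableSet_inter_preimage_ae_eq_smul (Set.to_countable _) hsing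
  refine ⟨Φ.ker ⊓ rightStabilizer μ, inf_le_left, Set.ext fun k => ?_,
    (Set.toFinite (Φ.ker : Set (ℤ → A))).subset inf_le_left,
    fibreAtoms_ae_eq_smul_and_support_ae_eq_smul hμΦ.measurable hrange le_rfl hU hUμ, ?_,
    isAEToOne_card hμΦ hrange inf_le_left hU hUμ⟩
  · exact and_congr (hA.shift_mem_ker_iff (hφ ▸ commute_shift_ofLocalRule))
      (map_mem_rightStabilizer_iff (f := hA.shiftHom)
        (hμσ.measurable.measurableEmbedding shift_injective) hμσ)
  · rw [← condPartitionEntropy_comap_eq_log_card hμΦ.measurable hrange le_rfl hU hUμ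
      (Finset.measurable_restrict _) (hφ ▸ injOn_restrict_Ico hL hR), hφ]
    exact entropy_ofLocalRule hL hR (hφ ▸ hμΦ)

open BipermCA in
theorem mainTheorem5 {A : Type*} [Finite A] [TopologicalSpace A] [DiscreteTopology A]
    [MeasurableSpace A] [DiscreteMeasurableSpace A] [Group (ℤ → A)]
    (hA : BipermCA.IsGroupShift A)
    (Φ : (ℤ → A) →* (ℤ → A)) (hΦ : BipermCA.IsBipermutativeCA Φ)
    (μ : Measure (ℤ → A)) [IsProbabilityMeasure μ]
    (hμΦ : MeasurePreserving Φ μ μ) (hμσ : BipermCA.TotallyErgodic BipermCA.shift μ) :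
    ∃ J : Subgroup (ℤ → A),
      J ≤ Φ.ker ∧
      (BipermCA.shift ⁻¹' (J : Set (ℤ → A)) = (J : Set (ℤ → A))) ∧
      (J : Set (ℤ → A)).Finite ∧
      (∀ᵐ x ∂μ, BipermCA.fibreAtoms Φ μ x = (fun j => x * j) '' (J : Set (ℤ → A)) ∧
        (BipermCA.fibreMeasure Φ μ x).support = (fun j => x * j) '' (J : Set (ℤ → A))) ∧
      BipermCA.entropy Φ μ = ((Real.log (Nat.card J) : ℝ) : EReal) ∧
      BipermCA.IsAEToOne Φ μ (Nat.card J) := by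
  obtain ⟨n, hn, hker⟩ := hA.exists_iterate_shift_eq_self hΦ
  exact mainTheorem5_general hA Φ hΦ μ hμΦ (hμσ 1 le_rfl).toMeasurePreserving hker (hμσ n hn)
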